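/- Let $n \ge 2$ and let $F_n$ be the free group of rank $n$. A free factor of $F_n$ is a subgroup generated by a subset of a basis of $F_n$, and an element of $F_n$ is separable if it is contained in a free factor different from $F_n$. Let $\mathrm{sep}_n$ be the set of separable elements, and let $\mathrm{Cay}(F_n,\mathrm{sep}_n)$ be the graph with vertex set $F_n$ and an edge joining $g$ to $sg$ for all $g \in F_n$ and $s \in \mathrm{sep}_n$. The Whitehead complex of $F_n$ is the quotient of this graph by the conjugation action of $F_n$: its vertices are the conjugacy classes of $F_n$, and two distinct classes are joined by an edge if and only if they have representatives joined by an edge in $\mathrm{Cay}(F_n,\mathrm{sep}_n)$. **Theorem.** The Whitehead complex of $F_n$ is connected, and for every natural number $m$ the group $\mathbb Z^m$ quasi-isometrically embeds into it. That is, if $d$ denotes the graph metric on the vertices of the Whitehead complex, there are a map $f$ from $\mathbb Z^m$ to the set of conjugacy classes of $F_n$ and constants $K \ge 1$, $C \ge 0$ such that, for all $x, y \in \mathbb Z^m$, $$\tfrac1K \|x-y\|_1 - C \;\le\; d(f(x), f(y)) \;\le\; K\|x-y\|_1 + C.$$ -/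

import Mathlib

/-- A subgroup `H` of `G` is a free factor if it is generated by a subset of a basis of `G`
(meaningful for a free group `G`). -/
def IsFreeFactor.{u} {G : Type u} [Group G] (H : Subgroup G) : Prop :=
  ∃ (ι : Type u) (b : FreeGroupBasis ι G) (s : Set ι), H = Subgroup.closure (b '' s)

/-- The set of separable elements: those contained in a proper free factor. -/
def separableElements (G : Type*) [Group G] : Set G :=
  {g | ∃ H : Subgroup G, IsFreeFactor H ∧ H ≠ ⊤ ∧ g ∈ H}

/-- The (undirected) Cayley graph of `G` with respect to `S`: the edges join `g` to `s * g`
for `g ∈ G` and `s ∈ S`. Loops are discarded, which does not affect distances. -/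
def cayleyGraph {G : Type*} [Group G] (S : Set G) : SimpleGraph G :=
  SimpleGraph.fromRel fun g h => ∃ s ∈ S, h = s * g

/-- The quotient of the Cayley graph by conjugation: the vertices are the conjugacy classes
of `G`, and two distinct classes are adjacent if and only if they have representatives which
are adjacent in the Cayley graph. -/
def cayleyGraphModConj {G : Type*} [Group G] (S : Set G) : SimpleGraph (ConjClasses G) :=
  (cayleyGraph S).map ConjClasses.mk

/-- The Whitehead complex of the free group of rank `n`. -/
def whiteheadComplex (n : ℕ) : SimpleGraph (ConjClasses (FreeGroup (Fin n))) :=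
  cayleyGraphModConj (separableElements (FreeGroup (Fin n)))

/-- The map `f` from `X` (with distance function `dX`) to `Y` (with distance function `dY`)
is a quasi-isometric embedding. -/
def IsQuasiIsometricEmbedding {X Y : Type*} (dX : X → X → ℝ) (dY : Y → Y → ℝ)
    (f : X → Y) : Prop :=
  ∃ K C : ℝ, 1 ≤ K ∧ 0 ≤ C ∧ ∀ x y : X,
    K⁻¹ * dX x y - C ≤ dY (f x) (f y) ∧ dY (f x) (f y) ≤ K * dX x y + C

/-- The word metric on `ℤ^m` for the standard generators. -/
def intLatticeDist (m : ℕ) (x y : Fin m → ℤ) : ℝ :=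
  ∑ i, |(x i : ℝ) - (y i : ℝ)|

/-!
Separable elements form a conjugation invariant generating set, so left multiplication of a
representative by a product of `k` conjugates of separable elements moves a conjugacy class by at
most `k`. This gives connectedness, and it makes `x ↦ γ₁ ^ x₁ ⋯ γₘ ^ xₘ` Lipschitz for any choice
of elements `γᵢ`. Conversely, a quasimorphism which is bounded on separable elements is Lipschitz on
conjugacy classes, up to an additive error. So it suffices to find `γᵢ` together with
quasimorphisms `φᵢ`, bounded on separable elements, such that `φᵢ` is bounded on the powers of `γⱼ`
for `j ≠ i` and grows linearly on the powers of `γᵢ`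
(`exists_isQuasiIsometricEmbedding`).

The quasimorphisms are Brooks counting quasimorphisms of words `wᵢ` in which every reduced word of
length two occurs. They vanish on cyclically reduced separable elements by a weak form of
Whitehead's cut vertex lemma (`notMem_separableElements`): a cyclically reduced `g` in which all
reduced words of length two occur is not separable. Indeed, suppose that `g` lies in a factor
missing the basis element `b i`. The set `E` of elements whose word in the basis `b` begins with
`b i` satisfies `E g = E`; it has finite coboundary, that is, `E` and `E t` differ by a finite set
for every `t`; and neither `E` nor its complement is finite. In the Cayley tree of the standard
basis, finite coboundary means that cones far from the identity lie in `E` or miss `E`. Two cones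
leaving the same vertex are joined by a translate of the axis of `g`, by the assumption on words of
length two. Since `E g = E`, if one of the two is almost contained in `E`, so is the other.
Descending towards the identity, `E` is finite or cofinite, a contradiction
(`finite_or_finite_compl_of_invariant`).

Finally, `wᵢ = b a ^ Lᵢ c`, where `c` is a reduced word beginning and ending with `b` that contains
all reduced words of length two, the lengths `Lᵢ` are distinct and exceed the length of `c`, and
`γᵢ` is the element represented by `wᵢ`. The long run of the letter `a` prevents `wᵢ` from occurring
in a power of `wⱼ` for `j ≠ i`, and in the inverse of a positive power of any `wⱼ`.
-/

/-! ### Quasimorphisms and distances in the quotient graph -/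

/-- A real function on a group is a quasimorphism of defect at most `D` if it is additive up to an
error of at most `D`. -/
def IsQuasimorphism {G : Type*} [Group G] (D : ℝ) (φ : G → ℝ) : Prop :=
  ∀ g h, |φ (g * h) - φ g - φ h| ≤ D

namespace IsQuasimorphism

variable {G : Type*} [Group G] {D : ℝ} {φ : G → ℝ}

lemma abs_map_one_le (hφ : IsQuasimorphism D φ) : |φ 1| ≤ D := by
  have := hφ 1 1
  rw [mul_one, sub_self, zero_sub, abs_neg] at this
  exact this

lemma abs_map_conj_sub_le (hφ : IsQuasimorphism D φ) (u g : G) :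
    |φ (u * g * u⁻¹) - φ g| ≤ 4 * D := by
  have h1 := abs_le.1 (hφ (u * g) u⁻¹)
  have h2 := abs_le.1 (hφ u g)
  have h3 := abs_le.1 (hφ u u⁻¹)
  rw [mul_inv_cancel] at h3
  have h4 := abs_le.1 hφ.abs_map_one_le
  rw [abs_le]
  constructor <;> linarith

lemma abs_sub_le_of_isConj (hφ : IsQuasimorphism D φ) {g h : G} (hgh : IsConj g h) :
    |φ h - φ g| ≤ 4 * D := by
  obtain ⟨u, rfl⟩ := isConj_iff.1 hgh
  exact hφ.abs_map_conj_sub_le u g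

lemma abs_map_list_prod_sub_le (hφ : IsQuasimorphism D φ) {ι : Type*} (a : ι → G) (l : List ι) :
    |φ (l.map a).prod - (l.map fun i => φ (a i)).sum| ≤ D * (l.length + 1) := by
  induction l with
  | nil => simpa using hφ.abs_map_one_le
  | cons i l ih =>
    have h := abs_le.1 (hφ (a i) (l.map a).prod)
    rw [abs_le] at ih ⊢
    simp only [List.map_cons, List.prod_cons, List.sum_cons, List.length_cons, Nat.cast_add,
      Nat.cast_one]
    constructor <;> nlinarith

end IsQuasimorphism

lemma SimpleGraph.Connected.abs_sub_le_mul_dist {V : Type*} {Γ : SimpleGraph V}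
    (hΓ : Γ.Connected) {A : ℝ} {Φ : V → ℝ} (hΦ : ∀ c d, Γ.Adj c d → |Φ c - Φ d| ≤ A) (c d : V) :
    |Φ c - Φ d| ≤ A * Γ.dist c d := by
  obtain ⟨p, hp⟩ := hΓ.exists_walk_length_eq_dist c d
  rw [← hp]
  clear hp
  induction p with
  | nil => simp
  | cons h p ih =>
    have h1 := hΦ _ _ h
    rw [abs_le] at ih h1 ⊢
    simp only [SimpleGraph.Walk.length_cons, Nat.cast_add, Nat.cast_one]
    constructor <;> linarith

section ConjInvariantSet

open scoped Pointwise

variable {G : Type*} [Group G] {S : Set G}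

lemma conj_mem_pow (hconj : ∀ s ∈ S, ∀ u : G, u * s * u⁻¹ ∈ S) {k : ℕ} {t : G} (ht : t ∈ S ^ k)
    (u : G) : u * t * u⁻¹ ∈ S ^ k := by
  induction k generalizing t with
  | zero => simpa using ht
  | succ k ih =>
    rw [pow_succ, Set.mem_mul] at ht ⊢
    obtain ⟨a, ha, s, hs, rfl⟩ := ht
    exact ⟨_, ih ha, _, hconj s hs u, by group⟩

lemma list_prod_mul_inv_mem_pow (hconj : ∀ s ∈ S, ∀ u : G, u * s * u⁻¹ ∈ S) {ι : Type*}
    {a b : ι → G} {N : ι → ℕ} (h : ∀ i, a i * (b i)⁻¹ ∈ S ^ N i) (l : List ι) :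
    (l.map a).prod * ((l.map b).prod)⁻¹ ∈ S ^ (l.map N).sum := by
  induction l with
  | nil => simp
  | cons i l ih =>
    simp only [List.map_cons, List.prod_cons, List.sum_cons]
    rw [add_comm, pow_add, Set.mem_mul]
    exact ⟨_, conj_mem_pow hconj ih (a i), _, h i, by group⟩

lemma zpow_mem_pow {L : ℕ} {γ : G} (h : γ ∈ S ^ L) (h' : γ⁻¹ ∈ S ^ L) (k : ℤ) :
    γ ^ k ∈ S ^ (L * k.natAbs) := by
  rw [pow_mul]
  obtain hk | hk := Int.natAbs_eq k
  · rw [hk, zpow_natCast, Int.natAbs_natCast]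
    exact Set.pow_mem_pow h
  · rw [hk, zpow_neg, zpow_natCast, Int.natAbs_neg, Int.natAbs_natCast, ← inv_pow]
    exact Set.pow_mem_pow h'

lemma exists_walk_of_mul_inv_mem_pow {k : ℕ} {g h : G} (ht : h * g⁻¹ ∈ S ^ k) :
    ∃ p : (cayleyGraphModConj S).Walk (ConjClasses.mk g) (ConjClasses.mk h), p.length ≤ k := by
  induction k generalizing h with
  | zero =>
    have : h = g := by simpa [mul_inv_eq_one] using ht
    subst this
    exact ⟨.nil, le_rfl⟩
  | succ k ih =>
    rw [pow_succ', Set.mem_mul] at ht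
    obtain ⟨s, hs, t, ht, hst⟩ := ht
    obtain ⟨p, hp⟩ := ih (h := t * g) (by simpa using ht)
    have hh : h = s * (t * g) := by rw [← mul_assoc, hst]; group
    by_cases hne : ConjClasses.mk (t * g) = ConjClasses.mk h
    · exact ⟨p.copy rfl hne, by simpa using hp.trans (Nat.le_succ k)⟩
    · have hadj : (cayleyGraphModConj S).Adj (ConjClasses.mk (t * g)) (ConjClasses.mk h) := by
        refine SimpleGraph.map_adj_apply' ?_ hne
        rw [cayleyGraph, SimpleGraph.fromRel_adj]
        exact ⟨fun h' => hne (by rw [h']), Or.inl ⟨s, hs, hh⟩⟩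
      refine ⟨p.concat hadj, ?_⟩
      rw [SimpleGraph.Walk.length_concat]
      omega

lemma cayleyGraphModConj_connected (hgen : ∀ g : G, ∃ k, g ∈ S ^ k) :
    (cayleyGraphModConj S).Connected := by
  rw [SimpleGraph.connected_iff]
  refine ⟨fun c d => ?_, ⟨ConjClasses.mk 1⟩⟩
  obtain ⟨g, rfl⟩ := ConjClasses.exists_rep c
  obtain ⟨h, rfl⟩ := ConjClasses.exists_rep d
  obtain ⟨k, hk⟩ := hgen (h * g⁻¹)
  exact (exists_walk_of_mul_inv_mem_pow hk).choose.reachable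

lemma dist_mk_mk_le {k : ℕ} {g h : G} (ht : h * g⁻¹ ∈ S ^ k) :
    (cayleyGraphModConj S).dist (ConjClasses.mk g) (ConjClasses.mk h) ≤ k := by
  obtain ⟨p, hp⟩ := exists_walk_of_mul_inv_mem_pow ht
  exact (SimpleGraph.dist_le p).trans hp

/-- A quasimorphism that is bounded on `S` is, up to an additive error, a Lipschitz function of the
conjugacy class for the graph metric. -/
lemma IsQuasimorphism.abs_sub_le_mul_dist {D : ℝ} {φ : G → ℝ} (hφ : IsQuasimorphism D φ)
    (hS : ∀ s ∈ S, |φ s| ≤ D) (hconn : (cayleyGraphModConj S).Connected) (g h : G) :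
    |φ g - φ h| ≤
      10 * D * (cayleyGraphModConj S).dist (ConjClasses.mk g) (ConjClasses.mk h) + 8 * D := by
  have hrep (g : G) : |φ g - φ (Quotient.out (ConjClasses.mk g))| ≤ 4 * D :=
    hφ.abs_sub_le_of_isConj (Quotient.mk_out (s := IsConj.setoid G) g)
  have hstep (g s : G) (hs : s ∈ S) : |φ g - φ (s * g)| ≤ 2 * D := by
    have h1 := abs_le.1 (hφ s g)
    have h2 := abs_le.1 (hS s hs)
    rw [abs_le]
    constructor <;> linarith
  have hadj : ∀ c d, (cayleyGraphModConj S).Adj c d →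
      |φ (Quotient.out c) - φ (Quotient.out d)| ≤ 10 * D := by
    intro c d hcd
    obtain ⟨-, g, h, hgh, rfl, rfl⟩ := (SimpleGraph.map_adj' _ _ _ _).1 hcd
    have h0 : |φ g - φ h| ≤ 2 * D := by
      rw [cayleyGraph, SimpleGraph.fromRel_adj] at hgh
      obtain ⟨-, ⟨s, hs, rfl⟩ | ⟨s, hs, rfl⟩⟩ := hgh
      · exact hstep g s hs
      · rw [abs_sub_comm]
        exact hstep h s hs
    have h1 := abs_le.1 (hrep g)
    have h2 := abs_le.1 (hrep h)
    rw [abs_le] at h0 ⊢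
    constructor <;> linarith
  have h0 := abs_le.1 (hconn.abs_sub_le_mul_dist (Φ := fun c => φ (Quotient.out c)) hadj
    (ConjClasses.mk g) (ConjClasses.mk h))
  have h1 := abs_le.1 (hrep g)
  have h2 := abs_le.1 (hrep h)
  rw [abs_le]
  constructor <;> linarith

/-- If `φ i` is a quasimorphism bounded on `S` that is bounded on the powers of `γ j` for `j ≠ i`
and grows linearly on the powers of `γ i`, then `x ↦ ∏ j, γ j ^ x j` embeds `ℤ^m`
quasi-isometrically into the conjugation quotient: conjugation invariance of `S` gives the upper
bound, and `φ i` recovers the coordinate `x i` up to a bounded error. -/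
theorem exists_isQuasiIsometricEmbedding {m : ℕ} {D : ℝ} {φ : Fin m → G → ℝ} {γ : Fin m → G}
    (hconj : ∀ s ∈ S, ∀ u : G, u * s * u⁻¹ ∈ S) (h1 : 1 ∈ S) (hgen : ∀ g : G, ∃ k, g ∈ S ^ k)
    (hD : 0 ≤ D) (hφ : ∀ i, IsQuasimorphism D (φ i)) (hS : ∀ i, ∀ s ∈ S, |φ i s| ≤ D)
    (hoff : ∀ i j, i ≠ j → ∀ k : ℤ, |φ i (γ j ^ k)| ≤ D)
    (hdiag : ∀ i, ∀ k : ℕ, (k : ℝ) ≤ φ i (γ i ^ k)) :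
    ∃ f : (Fin m → ℤ) → ConjClasses G, IsQuasiIsometricEmbedding (intLatticeDist m)
      (fun c d => ((cayleyGraphModConj S).dist c d : ℝ)) f := by
  have hconn := cayleyGraphModConj_connected hgen
  obtain ⟨L, hL⟩ : ∃ L, ∀ j, γ j ∈ S ^ L ∧ (γ j)⁻¹ ∈ S ^ L := by
    choose l hl using hgen
    refine ⟨∑ j, (l (γ j) + l (γ j)⁻¹), fun j => ?_⟩
    have hle : l (γ j) + l (γ j)⁻¹ ≤ ∑ j, (l (γ j) + l (γ j)⁻¹) :=
      Finset.single_le_sum (f := fun j => l (γ j) + l (γ j)⁻¹) (fun _ _ => Nat.zero_le _)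
        (Finset.mem_univ j)
    exact ⟨Set.pow_subset_pow_right h1 (by omega) (hl (γ j)),
      Set.pow_subset_pow_right h1 (by omega) (hl (γ j)⁻¹)⟩
  let F : (Fin m → ℤ) → G := fun x => ((List.finRange m).map fun j => γ j ^ x j).prod
  have hcoord (i : Fin m) (x : Fin m → ℤ) :
      |φ i (F x) - φ i (γ i ^ x i)| ≤ D * (m + 1) + m * D := by
    have hprod := (hφ i).abs_map_list_prod_sub_le (fun j => γ j ^ x j) (List.finRange m)
    rw [← Fin.sum_univ_def, List.length_finRange, ← Finset.add_sum_erase _ _ (Finset.mem_univ i)]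
      at hprod
    have hrest : |∑ j ∈ Finset.univ.erase i, φ i (γ j ^ x j)| ≤ m * D := by
      refine (Finset.abs_sum_le_sum_abs _ _).trans ?_
      refine (Finset.sum_le_card_nsmul _ _ D fun j hj => hoff i j (Finset.ne_of_mem_erase hj).symm
        _).trans ?_
      rw [nsmul_eq_mul]
      refine mul_le_mul_of_nonneg_right ?_ hD
      exact_mod_cast (Finset.card_le_univ _).trans (Fintype.card_fin m).le
    have e : ((List.finRange m).map fun j => γ j ^ x j).prod = F x := rfl
    rw [e] at hprod
    rw [abs_le] at hprod hrest ⊢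
    constructor <;> linarith
  have hgrow (i : Fin m) (p q : ℤ) (hpq : q ≤ p) :
      (p : ℝ) - q ≤ |φ i (γ i ^ p) - φ i (γ i ^ q)| + D := by
    obtain ⟨k, rfl⟩ : ∃ k : ℕ, p = k + q := ⟨(p - q).toNat, by omega⟩
    have h2 := abs_le.1 (hφ i (γ i ^ k) (γ i ^ q))
    rw [← zpow_natCast, ← zpow_add, zpow_natCast] at h2
    have h3 := hdiag i k
    have h4 := le_abs_self (φ i (γ i ^ ((k : ℤ) + q)) - φ i (γ i ^ q))
    push_cast
    linarith
  have hgrow' (i : Fin m) (p q : ℤ) :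
      |(p : ℝ) - q| ≤ |φ i (γ i ^ p) - φ i (γ i ^ q)| + D := by
    obtain h | h := le_total q p
    · rw [abs_of_nonneg (by exact_mod_cast sub_nonneg.2 h)]
      exact hgrow i p q h
    · rw [abs_sub_comm, abs_sub_comm (φ i _),
        abs_of_nonneg (by exact_mod_cast sub_nonneg.2 h)]
      exact hgrow i q p h
  set C : ℝ := 2 * (D * (m + 1) + m * D) + D + 8 * D with hC
  have hC0 : 0 ≤ C := by positivity
  set K : ℝ := m * (10 * D) + L + 1 with hK
  have hK1 : 1 ≤ K := by
    have : 0 ≤ m * (10 * D) + (L : ℝ) := by positivity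
    linarith
  refine ⟨fun x => ConjClasses.mk (F x), K, m * C, hK1, by positivity, fun x y => ⟨?_, ?_⟩⟩
  · set d : ℝ := ((cayleyGraphModConj S).dist (ConjClasses.mk (F x)) (ConjClasses.mk (F y)) : ℝ)
    have hd0 : 0 ≤ d := Nat.cast_nonneg _
    have hi (i : Fin m) : |(x i : ℝ) - y i| ≤ 10 * D * d + C := by
      have h2 := (hφ i).abs_sub_le_mul_dist (hS i) hconn (F x) (F y)
      have h3 := hgrow' i (x i) (y i)
      have h4 := hcoord i x
      have h5 := hcoord i y
      have h6 : |φ i (γ i ^ x i) - φ i (γ i ^ y i)| ≤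
          |φ i (F x) - φ i (F y)| + 2 * (D * (m + 1) + m * D) := by
        have h7 := abs_sub_abs_le_abs_sub (φ i (γ i ^ x i) - φ i (γ i ^ y i))
          (φ i (F x) - φ i (F y))
        have h8 : |(φ i (γ i ^ x i) - φ i (γ i ^ y i)) - (φ i (F x) - φ i (F y))| ≤
            2 * (D * (m + 1) + m * D) := by
          rw [abs_le] at h4 h5 ⊢
          constructor <;> linarith
        linarith
      linarith
    have hsum : intLatticeDist m x y ≤ m * (10 * D * d + C) := by
      have := Finset.sum_le_card_nsmul Finset.univ (fun i => |(x i : ℝ) - y i|) _ fun i _ => hi i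
      simpa only [intLatticeDist, Finset.card_univ, Fintype.card_fin, nsmul_eq_mul] using this
    have hle : intLatticeDist m x y ≤ K * (d + m * C) := by
      have : 0 ≤ (L + 1) * d + (K - 1) * (m * C) :=
        add_nonneg (by positivity) (mul_nonneg (by linarith) (by positivity))
      rw [hK] at this ⊢
      nlinarith
    have := inv_mul_le_of_le_mul₀ (by linarith) (by positivity) hle
    linarith
  · have hmem : F y * (F x)⁻¹ ∈ S ^ ((List.finRange m).map fun j => L * (y j - x j).natAbs).sum :=
      list_prod_mul_inv_mem_pow hconj (fun j => by
        rw [← zpow_sub]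
        exact zpow_mem_pow (hL j).1 (hL j).2 _) _
    have hle := dist_mk_mk_le hmem
    rw [← Fin.sum_univ_def, ← Finset.mul_sum] at hle
    have hle' : ((cayleyGraphModConj S).dist (ConjClasses.mk (F x)) (ConjClasses.mk (F y)) : ℝ) ≤
        L * intLatticeDist m x y := by
      refine (Nat.cast_le.2 hle).trans (le_of_eq ?_)
      rw [intLatticeDist, Nat.cast_mul, Nat.cast_sum]
      congr 1
      refine Finset.sum_congr rfl fun j _ => ?_
      rw [Nat.cast_natAbs, Int.cast_abs, Int.cast_sub, abs_sub_comm]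
    have h0 : 0 ≤ intLatticeDist m x y := Finset.sum_nonneg fun _ _ => abs_nonneg _
    have : (L : ℝ) * intLatticeDist m x y ≤ K * intLatticeDist m x y := by
      refine mul_le_mul_of_nonneg_right ?_ h0
      have : 0 ≤ m * (10 * D) := by positivity
      linarith
    have : 0 ≤ m * C := by positivity
    linarith

end ConjInvariantSet

/-! ### Cancellation in free groups -/

namespace FreeGroup

variable {α : Type*} [DecidableEq α]

lemma exists_cancellation_of_isReduced {L₁ L₂ : List (α × Bool)} (h₁ : IsReduced L₁)
    (h₂ : IsReduced L₂) :
    ∃ p r q, L₁ = p ++ r ∧ L₂ = invRev r ++ q ∧ IsReduced (p ++ q) := by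
  induction L₁ using List.reverseRecOn generalizing L₂ with
  | nil => exact ⟨[], [], L₂, rfl, rfl, h₂⟩
  | append_singleton L₁ x ih =>
    cases L₂ with
    | nil => exact ⟨L₁ ++ [x], [], [], by simp, rfl, by simpa using h₁⟩
    | cons y L₂ =>
      by_cases hxy : x.1 = y.1 → x.2 = y.2
      · refine ⟨L₁ ++ [x], [], y :: L₂, by simp, rfl, ?_⟩
        exact IsReduced.append_overlap (L₂ := [x]) h₁
          (List.isChain_cons_cons.2 ⟨hxy, h₂⟩) (by simp)
      · obtain ⟨p, r, q, rfl, rfl, hpq⟩ := ih (L₂ := L₂) (h₁.infix ⟨[], [x], by simp⟩)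
          (h₂.infix ⟨[y], [], by simp⟩)
        refine ⟨p, r ++ [x], q, by simp, ?_, hpq⟩
        obtain ⟨i, ε⟩ := x
        obtain ⟨j, δ⟩ := y
        obtain ⟨rfl, hne⟩ : i = j ∧ ε ≠ δ := by simpa using hxy
        have : δ = !ε := by cases ε <;> cases δ <;> simp_all
        simp [invRev, this]

/-- The reduced word of a product is obtained by cancelling a suffix of the first word against a
prefix of the second one. -/
lemma exists_cancellation (g h : FreeGroup α) :
    ∃ p r q, g.toWord = p ++ r ∧ h.toWord = invRev r ++ q ∧ (g * h).toWord = p ++ q := by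
  obtain ⟨p, r, q, h₁, h₂, hpq⟩ := exists_cancellation_of_isReduced (isReduced_toWord (x := g))
    (isReduced_toWord (x := h))
  refine ⟨p, r, q, h₁, h₂, ?_⟩
  rw [← hpq.reduce_eq, ← toWord_mk, ← mk_toWord (x := g), ← mk_toWord (x := h), h₁, h₂, ← mul_mk,
    ← mul_mk, ← mul_mk, ← inv_mk, mul_assoc, mul_inv_cancel_left]

lemma toWord_mul_of (h : FreeGroup α) (i : α) :
    (h * of i).toWord = h.toWord ++ [(i, true)] ∨ h.toWord = (h * of i).toWord ++ [(i, false)] := by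
  obtain ⟨p, r, q, h₁, h₂, h₃⟩ := exists_cancellation h (of i)
  rw [toWord_of, eq_comm, List.append_eq_singleton_iff] at h₂
  obtain ⟨hr, rfl⟩ | ⟨hr, rfl⟩ := h₂
  · have : r = [] := by rw [← invRev_invRev (L₁ := r), hr]; rfl
    left
    rw [h₁, h₃, this, List.append_nil]
  · have : r = [(i, false)] := by rw [← invRev_invRev (L₁ := r), hr]; rfl
    right
    rw [h₁, h₃, this, List.append_nil]

lemma IsReduced.invRev {L : List (α × Bool)} (h : IsReduced L) : IsReduced (invRev L) := by
  rw [isReduced_iff_reduce_eq, reduce_invRev, h.reduce_eq]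

lemma IsCyclicallyReduced.invRev {L : List (α × Bool)} (h : IsCyclicallyReduced L) :
    IsCyclicallyReduced (FreeGroup.invRev L) := by
  refine ⟨h.1.invRev, ?_⟩
  intro a ha b hb hab
  simp only [FreeGroup.invRev, List.getLast?_reverse, List.head?_reverse, List.head?_map,
    List.getLast?_map, Option.mem_def, Option.map_eq_some_iff] at ha hb
  obtain ⟨a', ha', rfl⟩ := ha
  obtain ⟨b', hb', rfl⟩ := hb
  have := h.2 b' hb' a' ha' hab.symm
  simp [this]

lemma IsCyclicallyReduced.toWord_pow {g : FreeGroup α} (h : IsCyclicallyReduced g.toWord)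
    (k : ℕ) : (g ^ k).toWord = (List.replicate k g.toWord).flatten := by
  rw [FreeGroup.toWord_pow, (h.flatten_replicate k).isReduced.reduce_eq]

lemma exists_conj_isCyclicallyReduced (g : FreeGroup α) :
    ∃ u h : FreeGroup α, IsCyclicallyReduced h.toWord ∧ g = u * h * u⁻¹ := by
  have hc := reduceCyclically.isCyclicallyReduced (isReduced_toWord (x := g))
  refine ⟨mk (reduceCyclically.conjugator g.toWord), mk (reduceCyclically g.toWord), ?_, ?_⟩
  · rwa [toWord_mk, hc.isReduced.reduce_eq]
  · rw [inv_mk, mul_mk, mul_mk, reduceCyclically.conj_conjugator_reduceCyclically, mk_toWord]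

/-! ### Almost invariant sets and cones -/

/-- The cone over a word `v`: the elements whose reduced word begins with `v`. -/
def cone (v : List (α × Bool)) : Set (FreeGroup α) :=
  {h | v <+: h.toWord}

/-- Far from the identity, a set with finite coboundary contains or misses whole cones. -/
lemma exists_forall_cone_subset_or_disjoint [Finite α] {E : Set (FreeGroup α)}
    (hE : ∀ t, {h | ¬ (h ∈ E ↔ h * t ∈ E)}.Finite) :
    ∃ R : ℕ, ∀ v, R ≤ v.length → cone v ⊆ E ∨ cone v ∩ E = ∅ := by
  have hfin : (⋃ x : α × Bool, {h | ¬ (h ∈ E ↔ h * mk [x] ∈ E)}).Finite :=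
    Set.finite_iUnion fun x => hE _
  obtain ⟨B, hB⟩ := (hfin.image fun h => h.toWord.length).bddAbove
  have hfar (h : FreeGroup α) (hh : B < h.toWord.length) (x : α × Bool) :
      h ∈ E ↔ h * mk [x] ∈ E := by
    by_contra hx
    exact hh.not_ge (hB ⟨h, Set.mem_iUnion.2 ⟨x, hx⟩, rfl⟩)
  refine ⟨B + 1, fun v hv => ?_⟩
  have key (q : List (α × Bool)) (hq : IsReduced (v ++ q)) : mk (v ++ q) ∈ E ↔ mk v ∈ E := by
    induction q using List.reverseRecOn with
    | nil => simp
    | append_singleton q x ih =>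
      have hq' : IsReduced (v ++ q) := hq.infix ⟨[], [x], by simp⟩
      rw [← ih hq', ← List.append_assoc, ← mul_mk]
      refine (hfar _ ?_ x).symm
      rw [toWord_mk, hq'.reduce_eq, List.length_append]
      omega
  have key' (h : FreeGroup α) (hh : h ∈ cone v) : h ∈ E ↔ mk v ∈ E := by
    obtain ⟨q, hq⟩ := hh
    rw [← key q (hq ▸ isReduced_toWord), hq, mk_toWord]
  by_cases hvE : mk v ∈ E
  · exact Or.inl fun h hh => (key' h hh).2 hvE
  · refine Or.inr (Set.eq_empty_of_forall_notMem ?_)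
    rintro h ⟨hh, hhE⟩
    exact hvE ((key' h hh).1 hhE)

/-- A ray in the direction of `g` that enters the cone over `v ++ [y]` along a letter `y` of `g`
stays in it, as there is no cancellation. -/
lemma toWord_mul_pow_of_isReduced {g : FreeGroup α} (hg : IsCyclicallyReduced g.toWord)
    {v p q : List (α × Bool)} {y : α × Bool} (hv : IsReduced (v ++ [y]))
    (hgw : g.toWord = p ++ [y] ++ q) (k : ℕ) :
    (mk (v ++ [y] ++ q) * g ^ k).toWord = v ++ [y] ++ q ++ (g ^ k).toWord := by
  have hred : IsReduced (v ++ [y] ++ (q ++ (g ^ k).toWord)) := by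
    refine IsReduced.append_overlap hv ?_ (by simp)
    refine (hg.flatten_replicate (k + 1)).isReduced.infix ⟨p, [], ?_⟩
    rw [List.replicate_succ, List.flatten_cons, ← hg.toWord_pow]
    simp [hgw]
  conv_lhs => rw [← mk_toWord (x := g ^ k), mul_mk, toWord_mk]
  rw [List.append_assoc _ q, hred.reduce_eq]

lemma infinite_cone_of_mem {g : FreeGroup α} (hg : IsCyclicallyReduced g.toWord)
    {v p q : List (α × Bool)} {y : α × Bool} (hv : IsReduced (v ++ [y]))
    (hgw : g.toWord = p ++ [y] ++ q) {E : Set (FreeGroup α)} (hE : ∀ h, h ∈ E ↔ h * g ∈ E)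
    (hmem : mk (v ++ [y] ++ q) ∈ E) : (cone (v ++ [y]) ∩ E).Infinite := by
  have hg0 : 0 < g.toWord.length := by simp [hgw]
  refine Set.infinite_of_injective_forall_mem
    (f := fun k : ℕ => mk (v ++ [y] ++ q) * g ^ k) ?_ fun k => ⟨?_, ?_⟩
  · intro k l hkl
    have := congrArg (fun h => h.toWord.length) hkl
    simp only [toWord_mul_pow_of_isReduced hg hv hgw, List.length_append, hg.toWord_pow,
      List.length_flatten,
      List.map_replicate, List.sum_replicate, smul_eq_mul] at this
    exact Nat.eq_of_mul_eq_mul_right hg0 (by omega)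
  · change _ <+: _
    rw [toWord_mul_pow_of_isReduced hg hv hgw, List.append_assoc (v ++ [y])]
    exact List.prefix_append _ _
  · induction k with
    | zero => simpa using hmem
    | succ k ih =>
      rw [pow_succ, ← mul_assoc]
      exact (hE _).1 ih

/-- A translate of the axis of `g` joins any two distinct cones leaving the same vertex, so a
`g`-invariant set cannot be almost all of one of them and almost nothing of the other. -/
lemma not_finite_cone_diff_and_finite_cone_inter {g : FreeGroup α}
    (hg : IsCyclicallyReduced g.toWord)
    (hturn : ∀ x y : α × Bool, (x.1 = y.1 → x.2 = y.2) → [x, y] <:+: g.toWord)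
    {E : Set (FreeGroup α)} (hE : ∀ h, h ∈ E ↔ h * g ∈ E) {v : List (α × Bool)} {x y : α × Bool}
    (hx : IsReduced (v ++ [x])) (hy : IsReduced (v ++ [y])) (hxy : x ≠ y) :
    ¬ ((cone (v ++ [x]) \ E).Finite ∧ (cone (v ++ [y]) ∩ E).Finite) := by
  rintro ⟨hfx, hfy⟩
  obtain ⟨p, q, hgw⟩ := hturn (x.1, !x.2) y (by
    intro h1
    have : x.2 ≠ y.2 := fun h2 => hxy (Prod.ext h1 h2)
    revert this
    cases x.2 <;> cases y.2 <;> simp)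
  have hgy : g.toWord = (p ++ [(x.1, !x.2)]) ++ [y] ++ q := by simp [← hgw]
  have hgi : IsCyclicallyReduced g⁻¹.toWord := by
    rw [toWord_inv]
    exact hg.invRev
  have hgx : g⁻¹.toWord = (invRev q ++ [(y.1, !y.2)]) ++ [x] ++ invRev p := by
    rw [toWord_inv, ← hgw]
    simp [invRev]
  have hE' : ∀ h, h ∈ E ↔ h * g⁻¹ ∈ E := fun h => by rw [hE (h * g⁻¹), inv_mul_cancel_right]
  have hrel : mk (v ++ [x] ++ invRev p) * g = mk (v ++ [y] ++ q) := by
    have hx' : mk [(x.1, !x.2)] = (mk [x])⁻¹ := by simp [inv_mk, invRev]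
    rw [← mk_toWord (x := g), hgy]
    simp only [← mul_mk, ← inv_mk, hx']
    group
  by_cases hmem : mk (v ++ [y] ++ q) ∈ E
  · exact infinite_cone_of_mem hg hy hgy hE hmem hfy
  · refine infinite_cone_of_mem (E := Eᶜ) hgi hx hgx (fun h => not_congr (hE' h)) ?_ hfx
    intro h
    rw [hE, hrel] at h
    exact hmem h

/-- If every reduced word of length two occurs in the cyclically reduced element `g`, then a
`g`-invariant set with finite coboundary is finite or cofinite. -/
theorem finite_or_finite_compl_of_invariant [Finite α] {g : FreeGroup α}
    (hg : IsCyclicallyReduced g.toWord)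
    (hturn : ∀ x y : α × Bool, (x.1 = y.1 → x.2 = y.2) → [x, y] <:+: g.toWord)
    {E : Set (FreeGroup α)} (hE : ∀ h, h ∈ E ↔ h * g ∈ E)
    (hfin : ∀ t, {h | ¬ (h ∈ E ↔ h * t ∈ E)}.Finite) : E.Finite ∨ Eᶜ.Finite := by
  obtain ⟨R, hR⟩ := exists_forall_cone_subset_or_disjoint hfin
  have key : ∀ k, ∀ v : List (α × Bool), R ≤ v.length + k →
      (cone v ∩ E).Finite ∨ (cone v \ E).Finite := by
    intro k
    induction k with
    | zero =>
      intro v hv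
      obtain h | h := hR v (by simpa using hv)
      · exact Or.inr (by rw [Set.sdiff_eq_empty.2 h]; exact Set.finite_empty)
      · exact Or.inl (by rw [h]; exact Set.finite_empty)
    | succ k ih =>
      intro v hv
      have hcover : cone v ⊆ {mk v} ∪ ⋃ x ∈ {x : α × Bool | IsReduced (v ++ [x])},
          cone (v ++ [x]) := by
        rintro h ⟨q, hq⟩
        cases q with
        | nil =>
          left
          rw [Set.mem_singleton_iff, ← mk_toWord (x := h), ← hq, List.append_nil]
        | cons x q =>
          right
          simp only [Set.mem_iUnion]
          refine ⟨x, ?_, q, by simpa using hq⟩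
          exact (isReduced_toWord (x := h)).infix ⟨[], q, by simpa using hq⟩
      -- It is enough that all the cones one step further meet `T` in finite sets, both for `T = E`
      -- and for `T = Eᶜ`.
      have hunion (T : Set (FreeGroup α))
          (hT : ∀ x, IsReduced (v ++ [x]) → (cone (v ++ [x]) ∩ T).Finite) :
          (cone v ∩ T).Finite := by
        refine Set.Finite.subset ((Set.finite_singleton (mk v)).union
          (Set.Finite.biUnion (Set.toFinite {x : α × Bool | IsReduced (v ++ [x])}) hT)) ?_
        rintro h ⟨hh, hhT⟩
        obtain h1 | h1 := hcover hh
        · exact Or.inl h1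
        · simp only [Set.mem_iUnion] at h1
          obtain ⟨x, hx, h1⟩ := h1
          exact Or.inr (Set.mem_biUnion hx ⟨h1, hhT⟩)
      have ih' (x : α × Bool) := ih (v ++ [x]) (by
        rw [List.length_append, List.length_singleton]
        omega)
      by_cases hall : ∀ x, IsReduced (v ++ [x]) → (cone (v ++ [x]) ∩ E).Finite
      · exact Or.inl (hunion E hall)
      · push Not at hall
        obtain ⟨x, hx, hxE⟩ := hall
        have hxE' := (ih' x).resolve_left hxE
        refine Or.inr (hunion Eᶜ fun y hy => ?_)
        by_cases hxy : x = y
        · exact hxy ▸ hxE'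
        · exact (ih' y).resolve_left fun h =>
            not_finite_cone_diff_and_finite_cone_inter hg hturn hE hx hy hxy ⟨hxE', h⟩
  have huniv : cone ([] : List (α × Bool)) = Set.univ :=
    Set.eq_univ_of_forall fun h => List.nil_prefix
  simpa [huniv, Set.compl_eq_univ_sdiff] using key R [] (by simp)

/-! ### Separable elements -/

lemma mem_startsWith_mul_of_iff {i j : α} {h : FreeGroup α} (hij : i = j → h ≠ 1) :
    h ∈ startsWith (i, true) ↔ h * of j ∈ startsWith (i, true) := by
  change h.toWord[0]? = _ ↔ (h * of j).toWord[0]? = _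
  rw [← List.head?_eq_getElem?, ← List.head?_eq_getElem?]
  obtain hw | hw := toWord_mul_of h j
  · rw [hw]
    cases hh : h.toWord with
    | nil =>
      have h1 : h = 1 := toWord_eq_nil_iff.1 hh
      simp only [List.head?_nil, List.nil_append, List.head?_cons, Option.some.injEq,
        Prod.mk.injEq, and_true, reduceCtorEq, false_iff]
      exact fun hji => hij hji.symm h1
    | cons a l => simp
  · rw [hw]
    cases hh : (h * of j).toWord <;> simp

lemma infinite_startsWith (i : α) : (startsWith (i, true)).Infinite := by
  refine Set.infinite_of_injective_forall_mem (f := fun k : ℕ => of i ^ (k + 1)) ?_ fun k => ?_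
  · intro k l hkl
    have := congrArg norm hkl
    simpa using this
  · change (toWord _)[0]? = _
    rw [toWord_of_pow, List.replicate_succ, List.getElem?_cons_zero]

lemma infinite_compl_startsWith (i : α) : (startsWith (i, true))ᶜ.Infinite := by
  refine Set.infinite_of_injective_forall_mem (f := fun k : ℕ => (of i ^ k)⁻¹) ?_ fun k => ?_
  · intro k l hkl
    have := congrArg norm hkl
    simpa using this
  · change ¬ (toWord _)[0]? = _
    rw [toWord_inv, toWord_of_pow]
    cases k <;> simp [invRev, List.replicate_succ']

end FreeGroup

lemma FreeGroupBasis.closure_range {ι G : Type*} [Group G] (b : FreeGroupBasis ι G) :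
    Subgroup.closure (Set.range b) = ⊤ := by
  have : Set.range b = b.repr.symm.toMonoidHom '' Set.range (FreeGroup.of : ι → FreeGroup ι) := by
    rw [← Set.range_comp]
    rfl
  rw [this, ← MonoidHom.map_closure, FreeGroup.closure_range_of, ← MonoidHom.range_eq_map]
  exact MonoidHom.range_eq_top.2 b.repr.symm.surjective

lemma finite_coboundary_of_closure {G : Type*} [Group G] {T : Set G}
    (hT : Subgroup.closure T = ⊤) {E : Set G}
    (hE : ∀ t ∈ T, {h | ¬ (h ∈ E ↔ h * t ∈ E)}.Finite) (t : G) :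
    {h | ¬ (h ∈ E ↔ h * t ∈ E)}.Finite := by
  have ht : t ∈ Subgroup.closure T := hT ▸ Subgroup.mem_top t
  induction ht using Subgroup.closure_induction with
  | mem t ht => exact hE t ht
  | one => simp
  | mul s t _ _ hs ht =>
    refine (hs.union (ht.preimage (mul_left_injective s).injOn)).subset ?_
    intro h hh
    by_contra hcon
    simp only [Set.mem_union, Set.mem_preimage, Set.mem_ofPred_eq, not_or, not_not] at hcon hh
    rw [mul_assoc] at hcon
    exact hh (hcon.1.trans hcon.2)
  | inv t _ ht =>
    refine (ht.image (· * t)).subset ?_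
    intro h hh
    refine ⟨h * t⁻¹, ?_, by simp⟩
    simpa [iff_comm] using hh

/-- An element of a proper free factor leaves invariant some set with finite coboundary which is
neither finite nor cofinite: the elements whose word, in a basis adapted to the factor, begins with
a basis element outside of the factor. -/
lemma exists_invariant_of_mem_separableElements {G : Type*} [Group G] {g : G}
    (hg : g ∈ separableElements G) :
    ∃ E : Set G, (∀ h, h ∈ E ↔ h * g ∈ E) ∧ (∀ t, {h | ¬ (h ∈ E ↔ h * t ∈ E)}.Finite) ∧
      E.Infinite ∧ Eᶜ.Infinite := by
  classical
  obtain ⟨H, ⟨ι, b, s, rfl⟩, hH, hgH⟩ := hg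
  obtain ⟨i, hi⟩ : ∃ i, i ∉ s := by
    by_contra! hs
    rw [Set.eq_univ_of_forall hs, Set.image_univ] at hH
    exact hH b.closure_range
  have hpre (T : Set (FreeGroup ι)) (hT : T.Infinite) : (b.repr ⁻¹' T).Infinite :=
    hT.preimage (by simp [b.repr.surjective.range_eq])
  refine ⟨b.repr ⁻¹' FreeGroup.startsWith (i, true), ?_, ?_,
    hpre _ (FreeGroup.infinite_startsWith i), hpre _ (FreeGroup.infinite_compl_startsWith i)⟩
  · induction hgH using Subgroup.closure_induction with
    | mem t ht =>
      obtain ⟨j, hj, rfl⟩ := ht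
      intro h
      rw [Set.mem_preimage, Set.mem_preimage, map_mul, b.repr_apply_coe]
      exact FreeGroup.mem_startsWith_mul_of_iff fun hij => absurd (hij ▸ hj) hi
    | one => simp
    | mul x y _ _ hx hy =>
      intro h
      rw [hx, hy, mul_assoc]
    | inv x _ hx =>
      intro h
      rw [hx (h * x⁻¹), inv_mul_cancel_right]
  · refine finite_coboundary_of_closure b.closure_range ?_
    rintro _ ⟨j, rfl⟩
    refine (Set.finite_singleton 1).subset fun h hh => ?_
    by_contra h1
    refine hh ?_
    rw [Set.mem_preimage, Set.mem_preimage, map_mul, b.repr_apply_coe]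
    exact FreeGroup.mem_startsWith_mul_of_iff fun _ h2 => h1 (by simpa using h2)

lemma conj_mem_separableElements {G : Type*} [Group G] {g : G} (hg : g ∈ separableElements G)
    (u : G) : u * g * u⁻¹ ∈ separableElements G := by
  obtain ⟨H, ⟨ι, b, s, rfl⟩, hH, hgH⟩ := hg
  have hmap : Subgroup.closure (b.map (MulAut.conj u) '' s) =
      (Subgroup.closure (b '' s)).map (MulAut.conj u).toMonoidHom := by
    rw [MonoidHom.map_closure, Set.image_image]
    rfl
  refine ⟨_, ⟨ι, b.map (MulAut.conj u), s, rfl⟩, ?_, ?_⟩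
  · rw [hmap]
    intro htop
    refine hH (Subgroup.map_injective (f := (MulAut.conj u).toMonoidHom)
      (MulAut.conj u).injective ?_)
    refine htop.trans ?_
    rw [← MonoidHom.range_eq_map]
    exact (MonoidHom.range_eq_top.2 (MulAut.conj u).surjective).symm
  · rw [hmap]
    exact ⟨g, hgH, rfl⟩

lemma inv_mem_separableElements {G : Type*} [Group G] {g : G} (hg : g ∈ separableElements G) :
    g⁻¹ ∈ separableElements G := by
  obtain ⟨H, hH, hne, hgH⟩ := hg
  exact ⟨H, hH, hne, H.inv_mem hgH⟩

lemma of_mem_separableElements {α : Type*} [Nontrivial α] (i : α) :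
    FreeGroup.of i ∈ separableElements (FreeGroup α) := by
  classical
  refine ⟨Subgroup.closure {FreeGroup.of i},
    ⟨α, FreeGroupBasis.ofFreeGroup α, {i}, by simp⟩, ?_, Subgroup.subset_closure rfl⟩
  intro htop
  obtain ⟨j, hj⟩ := exists_ne i
  -- The homomorphism killing every generator other than `j` is trivial on the closure.
  let f : FreeGroup α →* Multiplicative ℤ :=
    FreeGroup.lift fun k => if k = j then Multiplicative.ofAdd 1 else 1
  have hle : Subgroup.closure {FreeGroup.of i} ≤ f.ker := by
    rw [Subgroup.closure_le, Set.singleton_subset_iff]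
    simp [f, hj.symm]
  have hmem : FreeGroup.of j ∈ f.ker := hle (htop ▸ Subgroup.mem_top _)
  simp [f, MonoidHom.mem_ker] at hmem

lemma one_mem_separableElements {α : Type*} [Nontrivial α] :
    (1 : FreeGroup α) ∈ separableElements (FreeGroup α) := by
  obtain ⟨i, -⟩ := exists_pair_ne α
  obtain ⟨H, hH, hne, -⟩ := of_mem_separableElements i
  exact ⟨H, hH, hne, H.one_mem⟩

open scoped Pointwise in
lemma exists_mem_separableElements_pow {α : Type*} [Nontrivial α] (g : FreeGroup α) :
    ∃ k, g ∈ separableElements (FreeGroup α) ^ k := by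
  induction g using FreeGroup.induction_on with
  | C1 => exact ⟨0, by simp⟩
  | of i => exact ⟨1, by simpa using of_mem_separableElements i⟩
  | inv_of i _ => exact ⟨1, by simpa using inv_mem_separableElements (of_mem_separableElements i)⟩
  | mul x y hx hy =>
    obtain ⟨k, hk⟩ := hx
    obtain ⟨l, hl⟩ := hy
    exact ⟨k + l, by rw [pow_add]; exact Set.mul_mem_mul hk hl⟩

/-- A weak form of Whitehead's cut vertex lemma: if every reduced word of length two occurs in a
cyclically reduced word, that is, if already its Whitehead graph without the closing turn is
complete, then the word does not represent a separable element. -/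
theorem notMem_separableElements {α : Type*} [DecidableEq α] [Finite α] {g : FreeGroup α}
    (hg : FreeGroup.IsCyclicallyReduced g.toWord)
    (hturn : ∀ x y : α × Bool, (x.1 = y.1 → x.2 = y.2) → [x, y] <:+: g.toWord) :
    g ∉ separableElements (FreeGroup α) := by
  intro hsep
  obtain ⟨E, hE, hfin, hinf, hinf'⟩ := exists_invariant_of_mem_separableElements hsep
  exact (FreeGroup.finite_or_finite_compl_of_invariant hg hturn hE hfin).elim hinf hinf'

/-! ### Counting quasimorphisms -/

/-- The number of occurrences, possibly overlapping, of `w` as a contiguous subword of a list;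
an empty `w` is not counted at the end of the list. -/
def countInfix {β : Type*} [DecidableEq β] (w : List β) : List β → ℕ
  | [] => 0
  | a :: l => countInfix w l + if w <+: a :: l then 1 else 0

section countInfix

variable {β : Type*} [DecidableEq β] {w : List β}

lemma countInfix_add_le (l₁ l₂ : List β) :
    countInfix w l₁ + countInfix w l₂ ≤ countInfix w (l₁ ++ l₂) := by
  induction l₁ with
  | nil => simp [countInfix]
  | cons a l₁ ih =>
    have : w <+: a :: l₁ → w <+: a :: (l₁ ++ l₂) := fun h => h.trans (List.prefix_append _ l₂)
    simp only [countInfix, List.cons_append]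
    split_ifs <;> first | omega | simp_all

lemma countInfix_append_le (l₁ l₂ : List β) :
    countInfix w (l₁ ++ l₂) ≤ countInfix w l₁ + countInfix w l₂ + w.length := by
  suffices countInfix w (l₁ ++ l₂) ≤
      countInfix w l₁ + countInfix w l₂ + min l₁.length w.length by omega
  induction l₁ with
  | nil => simp [countInfix]
  | cons a l₁ ih =>
    -- An occurrence starting in `l₁` that is not contained in `l₁` is longer than what remains
    -- of `l₁`.
    have : w <+: a :: (l₁ ++ l₂) → ¬ w <+: a :: l₁ → l₁.length + 1 < w.length := by
      intro h h'
      by_contra! hlen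
      exact h' (List.prefix_of_prefix_length_le h (List.prefix_append (a :: l₁) l₂) hlen)
    simp only [countInfix, List.cons_append, List.length_cons]
    split_ifs with h1 h2
    · omega
    · have := this h1 h2
      omega
    · omega
    · omega

lemma countInfix_eq_zero {l : List β} (h : ¬ w <:+: l) : countInfix w l = 0 := by
  induction l with
  | nil => rfl
  | cons a l ih =>
    rw [countInfix, ih fun h' => h (List.infix_cons h'), if_neg fun h' => h h'.isInfix]

lemma one_le_countInfix_self (hw : w ≠ []) : 1 ≤ countInfix w w := by
  cases w with
  | nil => exact absurd rfl hw
  | cons a l => simp [countInfix]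

lemma le_countInfix_flatten_replicate (hw : w ≠ []) (k : ℕ) :
    k ≤ countInfix w (List.replicate k w).flatten := by
  induction k with
  | zero => simp
  | succ k ih =>
    rw [List.replicate_succ, List.flatten_cons]
    have := countInfix_add_le (w := w) w (List.replicate k w).flatten
    have := one_le_countInfix_self hw
    omega

end countInfix

namespace FreeGroup

variable {α : Type*} [DecidableEq α]

/-- The number of occurrences of `w` in a word minus the number of its occurrences in the inverse
word. -/
def signedCount (w l : List (α × Bool)) : ℝ :=
  countInfix w l - countInfix w (invRev l)

lemma signedCount_invRev (w l : List (α × Bool)) :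
    signedCount w (invRev l) = -signedCount w l := by
  rw [signedCount, signedCount, invRev_invRev, neg_sub]

lemma abs_signedCount_append_sub_le (w l₁ l₂ : List (α × Bool)) :
    |signedCount w (l₁ ++ l₂) - signedCount w l₁ - signedCount w l₂| ≤ w.length := by
  have h1 : (_ : ℝ) ≤ _ := Nat.cast_le.2 (countInfix_add_le (w := w) l₁ l₂)
  have h2 : (_ : ℝ) ≤ _ := Nat.cast_le.2 (countInfix_append_le (w := w) l₁ l₂)
  have h3 : (_ : ℝ) ≤ _ := Nat.cast_le.2 (countInfix_add_le (w := w) (invRev l₂) (invRev l₁))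
  have h4 : (_ : ℝ) ≤ _ := Nat.cast_le.2 (countInfix_append_le (w := w) (invRev l₂) (invRev l₁))
  push_cast at h1 h2 h3 h4
  rw [signedCount, signedCount, signedCount, invRev_append, abs_le]
  constructor <;> linarith

/-- The Brooks counting quasimorphism of the word `w`. -/
def brooks (w : List (α × Bool)) (g : FreeGroup α) : ℝ :=
  signedCount w g.toWord

lemma brooks_inv (w : List (α × Bool)) (g : FreeGroup α) : brooks w g⁻¹ = -brooks w g := by
  rw [brooks, toWord_inv, signedCount_invRev, brooks]

/-- Counting is additive up to the occurrences across the three points where the words `p`, `q`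
and `r` of a cancellation `p r · r⁻¹ q = p q` are joined. -/
lemma isQuasimorphism_brooks (w : List (α × Bool)) :
    IsQuasimorphism (3 * w.length) (brooks w) := by
  intro g h
  obtain ⟨p, r, q, h₁, h₂, h₃⟩ := exists_cancellation g h
  have e1 := abs_le.1 (abs_signedCount_append_sub_le w p r)
  have e2 := abs_le.1 (abs_signedCount_append_sub_le w (invRev r) q)
  have e3 := abs_le.1 (abs_signedCount_append_sub_le w p q)
  rw [signedCount_invRev] at e2
  rw [brooks, brooks, brooks, h₁, h₂, h₃, abs_le]
  constructor <;> linarith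

/-- If every reduced word of length two occurs in `w`, then the counting quasimorphism of `w` is
bounded on separable elements, because it vanishes on the cyclically reduced ones. -/
lemma abs_brooks_le_of_mem_separableElements [Finite α] {w : List (α × Bool)}
    (hturn : ∀ x y : α × Bool, (x.1 = y.1 → x.2 = y.2) → [x, y] <:+: w) {s : FreeGroup α}
    (hs : s ∈ separableElements (FreeGroup α)) : |brooks w s| ≤ 12 * w.length := by
  have hzero (g : FreeGroup α) (hg : IsCyclicallyReduced g.toWord)
      (hgs : g ∈ separableElements (FreeGroup α)) : countInfix w g.toWord = 0 :=
    countInfix_eq_zero fun h =>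
      notMem_separableElements hg (fun x y hxy => (hturn x y hxy).trans h) hgs
  obtain ⟨u, g, hg, rfl⟩ := exists_conj_isCyclicallyReduced s
  have hgs : g ∈ separableElements (FreeGroup α) := by
    have := conj_mem_separableElements hs u⁻¹
    rwa [inv_inv, show u⁻¹ * (u * g * u⁻¹) * u = g by group] at this
  have hg0 : brooks w g = 0 := by
    rw [brooks, signedCount, ← toWord_inv, hzero g hg hgs, hzero g⁻¹ (by
      rw [toWord_inv]
      exact hg.invRev) (inv_mem_separableElements hgs), sub_self]
  have := (isQuasimorphism_brooks w).abs_map_conj_sub_le u g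
  rw [hg0, sub_zero] at this
  linarith

end FreeGroup

/-! ### Words with a marked run -/

lemma getElem?_flatten_replicate {β : Type*} {w : List β} {k t : ℕ}
    (ht : t < k * w.length) : (List.replicate k w).flatten[t]? = w[t % w.length]? := by
  induction k generalizing t with
  | zero => simp at ht
  | succ k ih =>
    rw [List.replicate_succ, List.flatten_cons]
    obtain h | h := lt_or_ge t w.length
    · rw [List.getElem?_append_left h, Nat.mod_eq_of_lt h]
    · rw [List.getElem?_append_right h, ih (by rw [Nat.succ_mul] at ht; omega),
        ← Nat.mod_eq_sub_mod h]

/-- A subword of a power of `w` is read off from `w` at consecutive positions modulo the length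
of `w`. -/
lemma exists_getElem?_mod_of_infix {β : Type*} {u w : List β} {k : ℕ} (hu : u ≠ [])
    (h : u <:+: (List.replicate k w).flatten) :
    ∃ r < w.length, ∀ s < u.length, w[(r + s) % w.length]? = u[s]? := by
  obtain ⟨p, q, hpq⟩ := h
  have hlen := congrArg List.length hpq
  simp only [List.length_append, List.length_flatten, List.map_replicate, List.sum_replicate,
    smul_eq_mul] at hlen
  have hu' := List.length_pos_of_ne_nil hu
  have hw : 0 < w.length := Nat.pos_of_ne_zero fun h0 => by rw [h0] at hlen; omega
  refine ⟨p.length % w.length, Nat.mod_lt _ hw, fun s hs => ?_⟩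
  rw [Nat.mod_add_mod, ← getElem?_flatten_replicate (k := k) (by omega), ← hpq, List.append_assoc,
    List.getElem?_append_right (by omega), Nat.add_sub_cancel_left, List.getElem?_append_left hs]

/-- The word `b a^L c`. -/
def markedWord {β : Type*} (a b : β) (c : List β) (L : ℕ) : List β :=
  b :: (List.replicate L a ++ c)

section markedWord

variable {β : Type*} {a b : β} {c : List β} {L L' k : ℕ}

lemma length_markedWord : (markedWord a b c L).length = L + c.length + 1 := by
  simp [markedWord]

lemma getElem?_markedWord_zero : (markedWord a b c L)[0]? = some b := rfl

lemma getElem?_markedWord_of_le {s : ℕ} (h0 : 0 < s) (hs : s ≤ L) :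
    (markedWord a b c L)[s]? = some a := by
  obtain ⟨s, rfl⟩ := Nat.exists_eq_succ_of_ne_zero h0.ne'
  rw [markedWord, List.getElem?_cons_succ, List.getElem?_append_left (by simpa using hs),
    List.getElem?_replicate_of_lt hs]

lemma getElem?_markedWord_succ (hc : c.head? = some b) :
    (markedWord a b c L)[L + 1]? = some b := by
  rw [markedWord, List.getElem?_cons_succ, List.getElem?_append_right (by simp),
    List.length_replicate, Nat.sub_self, ← List.head?_eq_getElem?, hc]

/-- The length of the marked run is detected by subwords of powers, since the run is longer than
`c`. -/
lemma eq_of_markedWord_infix (hab : a ≠ b) (hc : c.head? = some b) (hL : c.length < L)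
    (h : markedWord a b c L <:+: (List.replicate k (markedWord a b c L')).flatten) : L = L' := by
  have hc0 : 0 < c.length := by
    cases c with
    | nil => simp at hc
    | cons x c => simp
  obtain ⟨r, hr, hrs⟩ := exists_getElem?_mod_of_infix (by simp [markedWord]) h
  rw [length_markedWord] at hr
  simp only [length_markedWord] at hrs
  obtain hr0 | hr0 := Nat.eq_zero_or_pos r
  · subst hr0
    by_contra hne
    obtain hlt | hlt := lt_or_gt_of_ne hne
    · have := hrs (L + 1) (by omega)
      rw [getElem?_markedWord_succ hc, zero_add, Nat.mod_eq_of_lt (by omega),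
        getElem?_markedWord_of_le (by omega) (by omega)] at this
      exact hab (Option.some_injective _ this)
    · have := hrs (L' + 1) (by omega)
      rw [zero_add, Nat.mod_eq_of_lt (by omega), getElem?_markedWord_succ hc,
        getElem?_markedWord_of_le (by omega) (by omega)] at this
      exact hab (Option.some_injective _ this).symm
  · exfalso
    obtain hle | hlt := le_or_gt r L'
    · have := hrs 0 (by omega)
      rw [add_zero, Nat.mod_eq_of_lt hr, getElem?_markedWord_of_le hr0 hle,
        getElem?_markedWord_zero] at this
      exact hab (Option.some_injective _ this)
    · -- The occurrence begins inside `c`, so its run contains the letter `b` of the next period.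
      have := hrs (L' + c.length + 1 - r) (by omega)
      rw [show r + (L' + c.length + 1 - r) = L' + c.length + 1 by omega, Nat.mod_self,
        getElem?_markedWord_zero, getElem?_markedWord_of_le (by omega) (by omega)] at this
      exact hab (Option.some_injective _ this).symm

lemma not_replicate_infix_flatten_markedWord {x : β} (hxa : x ≠ a) (hxb : x ≠ b)
    (hL : c.length < L) (hL1 : 1 < L) (hL' : 0 < L') :
    ¬ List.replicate L x <:+: (List.replicate k (markedWord a b c L')).flatten := by
  intro h
  obtain ⟨r, hr, hrs⟩ := exists_getElem?_mod_of_infix (by simp; omega) h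
  rw [length_markedWord] at hr
  simp only [length_markedWord, List.length_replicate] at hrs
  have hrs' : ∀ s < L, (markedWord a b c L')[(r + s) % (L' + c.length + 1)]? = some x :=
    fun s hs => (hrs s hs).trans (List.getElem?_replicate_of_lt hs)
  obtain hr0 | hr0 := Nat.eq_zero_or_pos r
  · subst hr0
    have := hrs' 1 hL1
    rw [zero_add, Nat.mod_eq_of_lt (by omega), getElem?_markedWord_of_le one_pos hL'] at this
    exact hxa (Option.some_injective _ this).symm
  · obtain hle | hlt := le_or_gt r L'
    · have := hrs' 0 (by omega)
      rw [add_zero, Nat.mod_eq_of_lt hr, getElem?_markedWord_of_le hr0 hle] at this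
      exact hxa (Option.some_injective _ this).symm
    · have := hrs' (L' + c.length + 1 - r) (by omega)
      rw [show r + (L' + c.length + 1 - r) = L' + c.length + 1 by omega, Nat.mod_self,
        getElem?_markedWord_zero] at this
      exact hxb (Option.some_injective _ this).symm

end markedWord

namespace FreeGroup

variable {α : Type*}

lemma exists_isReduced_join [Nontrivial α] (x y : α × Bool) : ∃ l, IsReduced ([x] ++ l ++ [y]) := by
  by_cases h : x.1 = y.1 → x.2 = y.2
  · exact ⟨[], by simpa [IsReduced] using h⟩
  · obtain ⟨j, hj⟩ := exists_ne x.1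
    have hxy : x.1 = y.1 := by
      by_contra hne
      exact h fun h' => absurd h' hne
    refine ⟨[(j, true)], ?_⟩
    simp only [IsReduced, List.cons_append, List.nil_append, List.isChain_cons_cons,
      List.isChain_singleton, and_true]
    exact ⟨fun h' => absurd h'.symm hj, fun h' => absurd (h'.trans hxy.symm) hj⟩

lemma exists_isReduced_forall_infix [Nontrivial α] (b : α × Bool)
    (T : List ((α × Bool) × (α × Bool))) (hT : ∀ t ∈ T, t.1.1 = t.2.1 → t.1.2 = t.2.2) :
    ∃ c : List (α × Bool), IsReduced c ∧ c.head? = some b ∧ c.getLast? = some b ∧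
      ∀ t ∈ T, [t.1, t.2] <:+: c := by
  induction T with
  | nil => exact ⟨[b], by simp⟩
  | cons t T ih =>
    obtain ⟨c, hc, hhead, hlast, hinf⟩ := ih fun t' ht' => hT t' (List.mem_cons_of_mem _ ht')
    obtain ⟨c', rfl⟩ : ∃ c', c = c' ++ [b] := by
      rw [List.getLast?_eq_some_iff] at hlast
      exact hlast
    obtain ⟨l₁, h₁⟩ := exists_isReduced_join b t.1
    obtain ⟨l₂, h₂⟩ := exists_isReduced_join t.2 b
    have ht : IsReduced ([t.1] ++ [t.2]) := by
      simpa [IsReduced] using hT t List.mem_cons_self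
    have h3 : IsReduced ([t.1] ++ [t.2] ++ (l₂ ++ [b])) :=
      IsReduced.append_overlap ht (by simpa using h₂) (by simp)
    have h4 : IsReduced ([b] ++ l₁ ++ [t.1] ++ ([t.2] ++ (l₂ ++ [b]))) :=
      IsReduced.append_overlap h₁ (by simpa using h3) (by simp)
    have h5 : IsReduced (c' ++ [b] ++ (l₁ ++ [t.1] ++ ([t.2] ++ (l₂ ++ [b])))) :=
      IsReduced.append_overlap hc (by simpa using h4) (by simp)
    refine ⟨_, h5, ?_, ?_, ?_⟩
    · rw [List.head?_append, hhead, Option.some_or]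
    · simp only [← List.append_assoc, List.getLast?_concat]
    · intro t' ht'
      obtain rfl | ht' := List.mem_cons.1 ht'
      · exact ⟨c' ++ [b] ++ l₁, l₂ ++ [b], by simp⟩
      · exact (hinf t' ht').trans (List.prefix_append _ _).isInfix

/-- There is a reduced word, beginning and ending with `b`, in which every reduced word of length
two occurs. -/
lemma exists_isReduced_forall_turn [Nontrivial α] [Finite α] (b : α × Bool) :
    ∃ c : List (α × Bool), IsReduced c ∧ c.head? = some b ∧ c.getLast? = some b ∧
      ∀ x y : α × Bool, (x.1 = y.1 → x.2 = y.2) → [x, y] <:+: c := by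
  have hfin := Set.toFinite {t : (α × Bool) × (α × Bool) | t.1.1 = t.2.1 → t.1.2 = t.2.2}
  obtain ⟨c, hc, hhead, hlast, hinf⟩ := exists_isReduced_forall_infix b hfin.toFinset.toList
    fun t ht => by simpa using ht
  exact ⟨c, hc, hhead, hlast, fun x y hxy => hinf (x, y) (by simpa using hxy)⟩

lemma isCyclicallyReduced_markedWord {a b : α × Bool} (hab : a.1 ≠ b.1) {c : List (α × Bool)}
    (hc : IsReduced c) (hhead : c.head? = some b) (hlast : c.getLast? = some b) {L : ℕ}
    (hL : 0 < L) : IsCyclicallyReduced (markedWord a b c L) := by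
  have hab' : a.1 = b.1 → a.2 = b.2 := fun h => absurd h hab
  have hba' : b.1 = a.1 → b.2 = a.2 := fun h => absurd h.symm hab
  refine ⟨?_, ?_⟩
  · have h1 : IsReduced (List.replicate L a ++ c) := by
      refine List.isChain_append.2 ⟨List.isChain_replicate_of_rel _ fun _ => rfl, hc, ?_⟩
      intro x hx y hy
      rw [hhead, Option.mem_some_iff] at hy
      rw [← hy, List.eq_of_mem_replicate (List.mem_of_mem_getLast? hx)]
      exact hab'
    obtain ⟨L, rfl⟩ := Nat.exists_eq_succ_of_ne_zero hL.ne'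
    exact List.isChain_cons_cons.2 ⟨hba', h1⟩
  · intro x hx y hy
    rw [markedWord, List.head?_cons, Option.mem_some_iff] at hy
    have : (markedWord a b c L).getLast? = some b := by
      rw [markedWord, ← List.cons_append, List.getLast?_append, hlast, Option.some_or]
    rw [this, Option.mem_some_iff] at hx
    rw [← hx, ← hy]
    exact fun _ => rfl

/-- The inverse of a power of a marked word contains no marked word, because it contains no long
run of the letter `a`. -/
lemma not_markedWord_infix_invRev {a b : α × Bool} (hab : a.1 ≠ b.1) {c : List (α × Bool)}
    {L L' k : ℕ} (hL : c.length < L) (hL1 : 1 < L) (hL' : 0 < L') :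
    ¬ markedWord a b c L <:+: invRev (List.replicate k (markedWord a b c L')).flatten := by
  intro h
  have hrun : List.replicate L a <:+: invRev (List.replicate k (markedWord a b c L')).flatten :=
    List.IsInfix.trans ⟨[b], c, by simp [markedWord]⟩ h
  obtain ⟨p, q, hpq⟩ := hrun
  refine not_replicate_infix_flatten_markedWord (x := (a.1, !a.2)) (a := a) (b := b) (c := c)
    (L := L) (L' := L') (k := k) (fun h' => ?_) (fun h' => ?_) hL hL1 hL'
    ⟨invRev q, invRev p, ?_⟩
  · simpa using congrArg Prod.snd h'
  · exact hab (congrArg (fun x => x.1) h')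
  · rw [← invRev_invRev (L₁ := (List.replicate k (markedWord a b c L')).flatten), ← hpq]
    simp [invRev]

end FreeGroup

/-! ### The embedding -/

open FreeGroup in
theorem theorem1p5 (n : ℕ) (hn : 2 ≤ n) (m : ℕ) :
    (whiteheadComplex n).Connected ∧
      ∃ f : (Fin m → ℤ) → ConjClasses (FreeGroup (Fin n)),
        IsQuasiIsometricEmbedding (intLatticeDist m)
          (fun c d => ((whiteheadComplex n).dist c d : ℝ)) f := by
  have : Nontrivial (Fin n) := Fin.nontrivial_iff_two_le.2 hn
  refine ⟨cayleyGraphModConj_connected exists_mem_separableElements_pow, ?_⟩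
  obtain ⟨i₀, i₁, hi⟩ := exists_pair_ne (Fin n)
  obtain ⟨c, hc, hhead, hlast, hturn⟩ := exists_isReduced_forall_turn (i₁, true)
  let L : Fin m → ℕ := fun i => c.length + 2 + i
  have hL (i : Fin m) : L i = c.length + 2 + i := rfl
  let w : Fin m → List (Fin n × Bool) := fun i => markedWord (i₀, true) (i₁, true) c (L i)
  have hw (i : Fin m) : IsCyclicallyReduced (w i) :=
    isCyclicallyReduced_markedWord hi hc hhead hlast (by rw [hL]; omega)
  have hpow (i : Fin m) (k : ℕ) : (mk (w i) ^ k).toWord = (List.replicate k (w i)).flatten := by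
    have : (mk (w i)).toWord = w i := by rw [toWord_mk, (hw i).isReduced.reduce_eq]
    rw [IsCyclicallyReduced.toWord_pow (by rw [this]; exact hw i), this]
  have hinv (i j : Fin m) (k : ℕ) : countInfix (w i) (invRev (mk (w j) ^ k).toWord) = 0 := by
    rw [hpow]
    exact countInfix_eq_zero (not_markedWord_infix_invRev hi (by rw [hL]; omega)
      (by rw [hL]; omega) (by rw [hL]; omega))
  have hoff (i j : Fin m) (hij : i ≠ j) (k : ℕ) : brooks (w i) (mk (w j) ^ k) = 0 := by
    rw [brooks, signedCount, hinv, hpow, countInfix_eq_zero, sub_self]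
    intro h
    have := eq_of_markedWord_infix (by simpa using hi) hhead (by rw [hL]; omega) h
    exact hij (Fin.ext (by rwa [hL, hL, Nat.add_left_cancel_iff] at this))
  have hlen (i : Fin m) : ((w i).length : ℝ) ≤ (c.length + 2 + m + c.length + 1 : ℕ) := by
    rw [length_markedWord, hL]
    exact Nat.cast_le.2 (by omega)
  refine exists_isQuasiIsometricEmbedding (D := 12 * (c.length + 2 + m + c.length + 1 : ℕ))
    (φ := fun i => brooks (w i)) (γ := fun i => mk (w i))
    (fun s hs u => conj_mem_separableElements hs u) one_mem_separableElements
    exists_mem_separableElements_pow (by positivity) ?_ ?_ ?_ ?_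
  · intro i g h
    have := isQuasimorphism_brooks (w i) g h
    have := hlen i
    have : (0 : ℝ) ≤ (w i).length := Nat.cast_nonneg _
    linarith
  · intro i s hs
    have h1 := abs_brooks_le_of_mem_separableElements (w := w i) (fun x y hxy =>
      (hturn x y hxy).trans ⟨(i₁, true) :: List.replicate (L i) (i₀, true), [], by
        simp [w, markedWord]⟩) hs
    have := hlen i
    linarith
  · intro i j hij k
    obtain ⟨k, rfl | rfl⟩ := k.eq_nat_or_neg
    · rw [zpow_natCast, hoff i j hij, abs_zero]
      positivity
    · rw [zpow_neg, zpow_natCast, brooks_inv, hoff i j hij, neg_zero, abs_zero]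
      positivity
  · intro i k
    rw [brooks, signedCount, hinv, hpow, Nat.cast_zero, sub_zero]
    exact Nat.cast_le.2 (le_countInfix_flatten_replicate (by simp [w, markedWord]) k)
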